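/- Let $\Bbbk$ be a field, $X=\{1,2\}$ with $1\prec 2$, and order words in $X$ lexicographically (a proper left factor of a word is smaller than the word). A nonempty word $\alpha$ is a Lyndon word if $\alpha\prec\gamma\beta$ for every factorization $\alpha=\beta\gamma$ into nonempty words; in particular letters are Lyndon words. Write $|\alpha|$ for the length of $\alpha$ and $\alpha(x)$ for the number of occurrences of the letter $x$ in $\alpha$. For elements $E_1,E_2$ of an associative unital $\Bbbk$-algebra $A$ define $E_\alpha$ for Lyndon words $\alpha$ recursively: $E_\alpha$ is the given element if $\alpha\in X$, and otherwise $E_\alpha=E_\beta E_\gamma-E_\gamma E_\beta$, where $\alpha=\beta\gamma$ with $\beta,\gamma$ Lyndon and $\gamma$ as long as possible. Let $\mathcal{SH}_{i,j}(E_2,E_1)$ be the sum of all products of $i$ factors $E_2$ and $j$ factors $E_1$, over all $\binom{i+j}{i}$ orders of the factors, so that $(E_1+E_2)^n=\sum_{k=0}^n\mathcal{SH}_{k,n-k}(E_2,E_1)$. In the free algebra $\Bbbk\langle E_1,E_2\rangle$, the monomials $E_{\alpha_1}^{t_1}\cdots E_{\alpha_n}^{t_n}$ with $\alpha_1\succ\cdots\succ\alpha_n$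 Lyndon form a basis. For a Lyndon word $\alpha$ let $C_{E_\alpha}\in\Bbbk$ be the coefficient of $E_\alpha$ in $\mathcal{SH}_{\alpha(2),\alpha(1)}(E_2,E_1)$ with respect to this basis; for $t\ge 1$ and $x\in X$, $E_{x\cdots x}$ ($t$ letters) means the basis monomial $E_x^t$, and $C_{E_{x\cdots x}}$ its coefficient in the shuffle type polynomial of the same content. (a) For all $s,t\ge 0$ with $s+t\ge 1$, $C_{E_{1^s2^t}}=1$, where $1^s2^t=\underbrace{1\cdots1}_{s}\underbrace{2\cdots2}_{t}$. (b) If $\Bbbk$ has characteristic $p>0$, then in $\Bbbk\langle E_1,E_2\rangle$, for $1\le k\le p-1$, $$\mathcal{SH}_{k,p-k}(E_2,E_1)=\sum_{\alpha(2)=k,\ \alpha(1)=p-k}C_{E_\alpha}E_\alpha ,$$ and therefore $$(E_1+E_2)^p=E_2^p+\sum_{|\alpha|=p}C_{E_\alpha}E_\alpha+E_1^p,$$ where both sums run over Lyndon words $\alpha$. (c) Let $\Bbbk$ have characteristic $p>0$ and let $E_1,E_2$ be elements of an associative unital $\Bbbk$-algebra $A$. If $E_\alpha=0$ in $A$ for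 all Lyndon words $\alpha$ with $|\alpha|=p$ and $\alpha(1)\ge2$, then $\mathcal{SH}_{k,p-k}(E_2,E_1)=0$ for $1\le k\le p-2$, $\mathcal{SH}_{p-1,1}(E_2,E_1)=E_{12^{p-1}}$, and $(E_1+E_2)^p=E_2^p+E_{12^{p-1}}+E_1^p$. Similarly, if $E_\alpha=0$ in $A$ for all Lyndon words $\alpha$ with $|\alpha|=p$ and $\alpha(2)\ge2$, then $\mathcal{SH}_{k,p-k}(E_2,E_1)=0$ for $2\le k\le p-1$, $\mathcal{SH}_{1,p-1}(E_2,E_1)=E_{1^{p-1}2}$, and $(E_1+E_2)^p=E_2^p+E_{1^{p-1}2}+E_1^p$. -/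

import Mathlib

/-! Words over a totally ordered alphabet `X` are lists, ordered lexicographically by Mathlib's order
on `List X` (a proper left factor of a word is smaller than the word). -/

namespace LyndonShirshov

universe u v

section Words

variable {X : Type u} [LinearOrder X]

/-- A Lyndon word: a nonempty word that is strictly smaller than `γβ` for each of its factorizations
`βγ` into nonempty words (for one-letter words the condition is void). -/
def IsLyndon (w : List X) : Prop :=
  w ≠ [] ∧ ∀ β γ : List X, β ≠ [] → γ ≠ [] → w = β ++ γ → w < γ ++ β

/-- `l` is the factorization of `w` as a non-increasing product of Lyndon words. -/
def IsLyndonFactorization (l : List (List X)) (w : List X) : Prop :=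
  (∀ u ∈ l, IsLyndon u) ∧ l.Pairwise (fun a b => b ≤ a) ∧ l.flatten = w

theorem append_lt_append_of_lt {a b : List X} (h : a < b) (hp : ¬ a <+: b) (c d : List X) :
    a ++ c < b ++ d := by
  induction a generalizing b with
  | nil => exact absurd List.nil_prefix hp
  | cons x a ih =>
    cases b with
    | nil => exact absurd h (List.not_lt_nil _)
    | cons y b =>
      rw [List.cons_append, List.cons_append, List.cons_lt_cons_iff]
      rw [List.cons_lt_cons_iff] at h
      rcases h with h | ⟨rfl, h⟩
      · exact Or.inl h
      · refine Or.inr ⟨rfl, ih h fun hh => hp ?_⟩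
        simpa using hh

theorem append_lt_append_left_iff (a : List X) {b c : List X} : a ++ b < a ++ c ↔ b < c := by
  induction a with
  | nil => simp
  | cons x a ih => simp [ih]

theorem lt_append_right (a : List X) {b : List X} (hb : b ≠ []) : a < a ++ b := by
  have h : a ++ [] < a ++ b := by
    rw [append_lt_append_left_iff]
    cases b with
    | nil => exact absurd rfl hb
    | cons x b => exact List.nil_lt_cons x b
  simpa using h

theorem le_of_prefix {a b : List X} (h : a <+: b) : a ≤ b := by
  obtain ⟨c, rfl⟩ := h
  by_cases hc : c = []
  · simp [hc]
  · exact (lt_append_right a hc).le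

theorem append_lt_append_of_length {a b : List X} (hl : a.length = b.length) (h : a < b)
    (c d : List X) : a ++ c < b ++ d := by
  refine append_lt_append_of_lt h (fun hp => ?_) c d
  exact h.ne (hp.eq_of_length hl)

theorem append_le_append_of_length {a b c d : List X} (hl : a.length = b.length) (h : a ≤ b)
    (h' : c ≤ d) : a ++ c ≤ b ++ d := by
  rcases h.lt_or_eq with h | rfl
  · exact (append_lt_append_of_length hl h c d).le
  · rcases h'.lt_or_eq with h' | rfl
    · exact ((append_lt_append_left_iff a).2 h').le
    · exact le_rfl

theorem IsLyndon.lt_suffix {w β γ : List X} (hw : IsLyndon w) (hβ : β ≠ []) (hγ : γ ≠ [])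
    (h : w = β ++ γ) : w < γ := by
  have h1 := hw.2 β γ hβ hγ h
  by_contra hlt
  have hle : γ ≤ w := not_lt.1 hlt
  have hne : γ ≠ w := by
    rintro rfl
    apply hβ
    have := congrArg List.length h
    rw [List.length_append] at this
    exact List.length_eq_zero_iff.1 (by omega)
  have hγw : γ < w := lt_of_le_of_ne hle hne
  by_cases hp : γ <+: w
  · obtain ⟨δ, hδ⟩ := hp
    have hδβ : δ < β := by
      rw [← hδ] at h1
      exact (append_lt_append_left_iff γ).1 h1
    have hlen : δ.length = β.length := by
      have e := congrArg List.length (hδ.trans h)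
      simp only [List.length_append] at e
      omega
    have hδ0 : δ ≠ [] := by
      rintro rfl
      exact hβ (List.length_eq_zero_iff.1 (by simpa using hlen.symm))
    have h2 := hw.2 γ δ hγ hδ0 hδ.symm
    have h3 : δ ++ γ < β ++ γ := append_lt_append_of_length hlen hδβ γ γ
    rw [← h] at h3
    exact lt_asymm h2 h3
  · have := append_lt_append_of_lt hγw hp β []
    rw [List.append_nil] at this
    exact lt_asymm h1 this

theorem isLyndon_of_lt_suffix {w : List X} (h0 : w ≠ [])
    (h : ∀ β γ : List X, β ≠ [] → γ ≠ [] → w = β ++ γ → w < γ) : IsLyndon w :=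
  ⟨h0, fun β γ hβ hγ e => (h β γ hβ hγ e).trans (lt_append_right γ hβ)⟩

theorem isLyndon_singleton (x : X) : IsLyndon [x] := by
  refine ⟨by simp, fun β γ hβ hγ e => ?_⟩
  have e := congrArg List.length e
  have h1 := List.length_pos_iff.2 hβ
  have h2 := List.length_pos_iff.2 hγ
  simp at e
  omega

theorem IsLyndon.append {a b : List X} (ha : IsLyndon a) (hb : IsLyndon b) (h : a < b) :
    IsLyndon (a ++ b) := by
  have hab : a ++ b < b := by
    by_cases hp : a <+: b
    · obtain ⟨c, hc⟩ := hp
      have hc0 : c ≠ [] := by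
        rintro rfl
        rw [List.append_nil] at hc
        exact h.ne hc
      have := hb.lt_suffix ha.1 hc0 hc.symm
      conv_rhs => rw [← hc]
      exact (append_lt_append_left_iff a).2 this
    · simpa using append_lt_append_of_lt h hp b []
  refine isLyndon_of_lt_suffix (by simp [ha.1]) fun β γ hβ hγ e => ?_
  rcases List.append_eq_append_iff.1 e with ⟨t, h1, h2⟩ | ⟨t, h1, h2⟩
  · by_cases ht : t = []
    · subst ht
      simp only [List.nil_append] at h2
      rwa [← h2]
    · exact hab.trans (hb.lt_suffix ht hγ h2)
  · by_cases ht : t = []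
    · subst ht
      simp only [List.nil_append] at h2
      rwa [h2]
    · have h3 := ha.lt_suffix hβ ht h1
      rw [h2]
      refine append_lt_append_of_lt h3 (fun hp => ?_) _ _
      have h4 := hp.length_le
      rw [h1, List.length_append] at h4
      have := List.length_pos_iff.2 hβ
      omega

theorem exists_factorization_append (l : List (List X)) (a : List X) (ha : IsLyndon a)
    (hl : IsLyndonFactorization l l.flatten) :
    ∃ l', IsLyndonFactorization l' (a ++ l.flatten) := by
  induction l generalizing a with
  | nil => exact ⟨[a], by simpa using ha, by simp, by simp⟩
  | cons b l ih =>
    obtain ⟨h1, h2, -⟩ := hl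
    rw [List.pairwise_cons] at h2
    by_cases hab : b ≤ a
    · refine ⟨a :: b :: l, ?_, ?_, by simp⟩
      · intro u hu
        rcases List.mem_cons.1 hu with rfl | hu
        · exact ha
        · exact h1 u hu
      · refine List.pairwise_cons.2 ⟨fun c hc => ?_, List.pairwise_cons.2 h2⟩
        rcases List.mem_cons.1 hc with rfl | hc
        · exact hab
        · exact (h2.1 c hc).trans hab
    · obtain ⟨l', hl'⟩ := ih (a ++ b) (ha.append (h1 b (by simp)) (not_le.1 hab))
        ⟨fun u hu => h1 u (List.mem_cons_of_mem _ hu), h2.2, rfl⟩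
      exact ⟨l', by simpa using hl'⟩

theorem exists_factorization (w : List X) : ∃ l, IsLyndonFactorization l w := by
  induction w with
  | nil => exact ⟨[], by simp, by simp, by simp⟩
  | cons x w ih =>
    obtain ⟨l, h1, h2, rfl⟩ := ih
    exact exists_factorization_append l [x] (isLyndon_singleton x) ⟨h1, h2, rfl⟩

theorem exists_suffix_le (r : List (List X)) (a t : List X) (hr : ∀ b ∈ r, b ≤ a)
    (ht : t ≠ []) (hp : t <+: r.flatten) : ∃ q, q ≠ [] ∧ q <:+ t ∧ q ≤ a := by
  induction r generalizing t with
  | nil => simp at hp; exact absurd hp ht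
  | cons b r ih =>
    have hp' : t <+: b ∨ ∃ t', t = b ++ t' ∧ t' <+: r.flatten := by
      obtain ⟨s, hs⟩ := hp
      rw [List.flatten_cons] at hs
      rcases List.append_eq_append_iff.1 hs with ⟨c, h1, -⟩ | ⟨c, h1, h2⟩
      · exact Or.inl ⟨c, h1.symm⟩
      · exact Or.inr ⟨c, h1, s, h2.symm⟩
    clear hp
    rcases hp' with hp | ⟨t', rfl, hp⟩
    · exact ⟨t, ht, List.suffix_rfl, (le_of_prefix hp).trans (hr b (by simp))⟩
    · by_cases ht' : t' = []
      · subst ht'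
        rw [List.append_nil] at ht ⊢
        exact ⟨b, ht, List.suffix_rfl, hr b (by simp)⟩
      · obtain ⟨q, h1, h2, h3⟩ := ih t' (fun c hc => hr c (List.mem_cons_of_mem _ hc)) ht' hp
        exact ⟨q, h1, h2.trans (List.suffix_append _ _), h3⟩

theorem head_length_le {a b : List X} {r s : List (List X)} (ha : a ≠ []) (hb : IsLyndon b)
    (hr : ∀ c ∈ r, c ≤ a) (h : a ++ r.flatten = b ++ s.flatten) : b.length ≤ a.length := by
  by_contra hlt
  rcases List.append_eq_append_iff.1 h with ⟨t, h1, h2⟩ | ⟨t, h1, h2⟩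
  · have ht : t ≠ [] := by
      rintro rfl
      rw [List.append_nil] at h1
      exact hlt (by rw [h1])
    obtain ⟨q, hq, ⟨p, hqs⟩, hqa⟩ := exists_suffix_le r a t hr ht ⟨_, h2.symm⟩
    have h3 : b < q := hb.lt_suffix (β := a ++ p) (by simp [ha]) hq (by rw [h1, ← hqs]; simp)
    have h4 : a ≤ b := le_of_prefix ⟨t, h1.symm⟩
    exact absurd (h3.trans_le (hqa.trans h4)) (lt_irrefl _)
  · rw [h1, List.length_append] at hlt
    omega

theorem factorization_unique {l l' : List (List X)} {w : List X}
    (h : IsLyndonFactorization l w) (h' : IsLyndonFactorization l' w) : l = l' := by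
  induction l generalizing l' w with
  | nil =>
    obtain ⟨h1, -, h2⟩ := h'
    cases l' with
    | nil => rfl
    | cons b s =>
      have := (h1 b (by simp)).1
      rw [← h.2.2] at h2
      simp at h2
      exact absurd h2.1 this
  | cons a r ih =>
    obtain ⟨h1, h2, h3⟩ := h
    obtain ⟨k1, k2, k3⟩ := h'
    cases l' with
    | nil =>
      rw [← k3] at h3
      simp at h3
      exact absurd h3.1 (h1 a (by simp)).1
    | cons b s =>
      rw [List.pairwise_cons] at h2 k2
      have e : a ++ r.flatten = b ++ s.flatten := by
        simpa using h3.trans k3.symm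
      have ha := h1 a (by simp)
      have hb := k1 b (by simp)
      have hl : a.length = b.length :=
        le_antisymm (head_length_le hb.1 ha k2.1 e.symm) (head_length_le ha.1 hb h2.1 e)
      obtain ⟨rfl, e'⟩ := List.append_inj e hl
      rw [ih (l' := s) (w := r.flatten) ⟨fun u hu => h1 u (List.mem_cons_of_mem _ hu), h2.2, rfl⟩
        ⟨fun u hu => k1 u (List.mem_cons_of_mem _ hu), k2.2, e'.symm⟩]

/-- The unique factorization of a word as a non-increasing product of Lyndon words. -/
noncomputable def lyndonFactorization (w : List X) : List (List X) :=
  (exists_factorization w).choose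

theorem lyndonFactorization_spec (w : List X) :
    IsLyndonFactorization (lyndonFactorization w) w :=
  (exists_factorization w).choose_spec

theorem lyndonFactorization_of_isLyndon {w : List X} (hw : IsLyndon w) :
    lyndonFactorization w = [w] :=
  factorization_unique (lyndonFactorization_spec w) ⟨by simpa using hw, by simp, by simp⟩

/-- The length of the left factor in the standard factorization: the least `i` (so that the right
factor is as long as possible) for which `w` is cut after `i` letters into two Lyndon words. -/
noncomputable def standardCut (w : List X) : ℕ :=
  sInf {i | 0 < i ∧ i < w.length ∧ IsLyndon (w.take i) ∧ IsLyndon (w.drop i)}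

theorem exists_standardCut {w : List X} (hw : IsLyndon w) (h2 : 2 ≤ w.length) :
    ∃ i, 0 < i ∧ i < w.length ∧ IsLyndon (w.take i) ∧ IsLyndon (w.drop i) := by
  classical
  have hex : ∃ i, 0 < i ∧ i < w.length ∧ IsLyndon (w.drop i) := by
    refine ⟨w.length - 1, by omega, by omega, ?_⟩
    obtain ⟨x, hx⟩ := List.length_eq_one_iff.1
      (show (w.drop (w.length - 1)).length = 1 by rw [List.length_drop]; omega)
    rw [hx]
    exact isLyndon_singleton x
  obtain ⟨h0, h1, hd⟩ := Nat.find_spec hex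
  have hmin := fun m => Nat.find_min hex (m := m)
  generalize Nat.find hex = i at h0 h1 hd hmin
  refine ⟨i, h0, h1, ?_, hd⟩
  obtain ⟨l, k1, k2, k3⟩ := exists_factorization (w.take i)
  rcases List.eq_nil_or_concat l with rfl | ⟨l0, c, rfl⟩
  · have := congrArg List.length k3
    simp at this
    omega
  simp only [List.concat_eq_append, List.flatten_append, List.flatten_cons, List.flatten_nil,
    List.append_nil] at k1 k2 k3
  have hc : IsLyndon c := k1 c (by simp)
  have hw' : w = l0.flatten ++ (c ++ w.drop i) := by
    rw [← List.append_assoc, k3, List.take_append_drop]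
  rcases l0.eq_nil_or_concat with rfl | ⟨l1, b, rfl⟩
  · rw [← k3]
    simpa using hc
  · exfalso
    simp only [List.concat_eq_append] at *
    by_cases hcd : c < w.drop i
    · refine hmin (l1 ++ [b]).flatten.length ?_ ⟨?_, ?_, ?_⟩
      · have e := congrArg List.length k3
        have := List.length_pos_iff.2 hc.1
        rw [List.length_append, List.length_take] at e
        omega
      · have := List.length_pos_iff.2 (k1 b (by simp)).1
        simp
        omega
      · have e := congrArg List.length hw'
        have := List.length_pos_iff.2 hc.1
        rw [List.length_append, List.length_append] at e
        omega
      · have e : w.drop (l1 ++ [b]).flatten.length = c ++ w.drop i := by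
          conv_lhs => rw [hw']
          rw [List.drop_left]
        rw [e]
        exact hc.append hd hcd
    · have hf : IsLyndonFactorization ((l1 ++ [b] ++ [c]) ++ [w.drop i]) w := by
        refine ⟨?_, ?_, ?_⟩
        · intro u hu
          rcases List.mem_append.1 hu with hu | hu
          · exact k1 u hu
          · rw [List.mem_singleton.1 hu]
            exact hd
        · rw [List.pairwise_append]
          refine ⟨k2, by simp, ?_⟩
          intro u hu v hv
          rw [List.mem_singleton.1 hv]
          refine (not_lt.1 hcd).trans ?_
          rw [List.pairwise_append] at k2
          rcases List.mem_append.1 hu with hu | hu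
          · exact k2.2.2 u hu c (by simp)
          · rw [List.mem_singleton.1 hu]
        · conv_rhs => rw [hw']
          simp
      have := factorization_unique hf (l' := [w]) ⟨by simpa using hw, by simp, by simp⟩
      have := congrArg List.length this
      simp at this

theorem standardCut_spec {w : List X} (hw : IsLyndon w) (h2 : 2 ≤ w.length) :
    0 < standardCut w ∧ standardCut w < w.length ∧ IsLyndon (w.take (standardCut w)) ∧
      IsLyndon (w.drop (standardCut w)) :=
  Nat.sInf_mem (exists_standardCut hw h2)

/-- The Lyndon-Shirshov bracketing `E_w` of a Lyndon word `w`, evaluated at elements `e x` of a ring: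
`E_x = e x` for a letter `x`, and `E_w = E_β E_γ - E_γ E_β` if `(β, γ)` is the standard factorization
of `w`. (Only Lyndon words `w` matter; a word without standard factorization that is not a letter
is sent to the product of its letters.) -/
noncomputable def lyndonBracket {A : Type v} [Ring A] (e : X → A) (w : List X) : A :=
  if _h : 0 < standardCut w ∧ standardCut w < w.length then
    lyndonBracket e (w.take (standardCut w)) * lyndonBracket e (w.drop (standardCut w)) -
      lyndonBracket e (w.drop (standardCut w)) * lyndonBracket e (w.take (standardCut w))
  else (w.map e).prod
termination_by w.length
decreasing_by all_goals (simp only [List.length_take, List.length_drop]; omega)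

/-- The Poincaré-Birkhoff-Witt monomial `E_{β₁} E_{β₂} ⋯ E_{βₙ}` with `β₁ ≥ β₂ ≥ ⋯ ≥ βₙ` Lyndon,
indexed by the word `w = β₁ β₂ ⋯ βₙ`. -/
noncomputable def pbwMonomial {A : Type v} [Ring A] (e : X → A) (w : List X) : A :=
  ((lyndonFactorization w).map (lyndonBracket e)).prod

theorem pbwMonomial_of_isLyndon {A : Type v} [Ring A] (e : X → A) {w : List X} (hw : IsLyndon w) :
    pbwMonomial e w = lyndonBracket e w := by
  simp [pbwMonomial, lyndonFactorization_of_isLyndon hw]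

end Words

section Basis

variable {X : Type u} (k : Type v) [Field k]

/-- A word as an element of the free algebra. -/
noncomputable def wordElem (w : List X) : FreeAlgebra k X := (w.map (FreeAlgebra.ι k)).prod

theorem wordElem_append (a b : List X) :
    wordElem k (a ++ b) = wordElem k a * wordElem k b := by
  simp [wordElem]

theorem basisFreeMonoid_apply (w : List X) :
    FreeAlgebra.basisFreeMonoid k X (FreeMonoid.ofList w) = wordElem k w := by
  simp [FreeAlgebra.basisFreeMonoid, FreeAlgebra.equivMonoidAlgebraFreeMonoid, wordElem,
    FreeMonoid.lift_apply]

variable [LinearOrder X]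

/-- The span of the rearrangements of `w` that are strictly larger than `w`. -/
def gtSpan (w : List X) : Submodule k (FreeAlgebra k X) :=
  Submodule.span k (wordElem k '' {z | z.Perm w ∧ w < z})

/-- The span of the rearrangements of `w` that are not smaller than `w`. -/
def geSpan (w : List X) : Submodule k (FreeAlgebra k X) :=
  Submodule.span k (wordElem k '' {z | z.Perm w ∧ w ≤ z})

variable {k}

theorem gtSpan_le_geSpan (w : List X) : gtSpan k w ≤ geSpan k w :=
  Submodule.span_mono (Set.image_mono fun _ hz => ⟨hz.1, hz.2.le⟩)

theorem wordElem_mem_geSpan (w : List X) : wordElem k w ∈ geSpan k w :=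
  Submodule.subset_span ⟨w, ⟨List.Perm.refl _, le_rfl⟩, rfl⟩

theorem mem_geSpan_of_sub {w : List X} {f : FreeAlgebra k X} (h : f - wordElem k w ∈ gtSpan k w) :
    f ∈ geSpan k w := by
  have := (geSpan k w).add_mem (gtSpan_le_geSpan w h) (wordElem_mem_geSpan w)
  simpa using this

theorem gt_mul_ge {a b : List X} {f g : FreeAlgebra k X} (hf : f ∈ gtSpan k a)
    (hg : g ∈ geSpan k b) : f * g ∈ gtSpan k (a ++ b) := by
  have h := Submodule.mul_mem_mul hf hg
  rw [gtSpan, geSpan, Submodule.span_mul_span] at h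
  refine Submodule.span_mono ?_ h
  rintro _ ⟨_, ⟨x, hx, rfl⟩, _, ⟨y, hy, rfl⟩, rfl⟩
  exact ⟨x ++ y, ⟨hx.1.append hy.1, append_lt_append_of_length hx.1.length_eq.symm hx.2 _ _⟩,
    wordElem_append k x y⟩

theorem ge_mul_gt {a b : List X} {f g : FreeAlgebra k X} (hf : f ∈ geSpan k a)
    (hg : g ∈ gtSpan k b) : f * g ∈ gtSpan k (a ++ b) := by
  have h := Submodule.mul_mem_mul hf hg
  rw [gtSpan, geSpan, Submodule.span_mul_span] at h
  refine Submodule.span_mono ?_ h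
  rintro _ ⟨_, ⟨x, hx, rfl⟩, _, ⟨y, hy, rfl⟩, rfl⟩
  refine ⟨x ++ y, ⟨hx.1.append hy.1, ?_⟩, wordElem_append k x y⟩
  rcases hx.2.lt_or_eq with h | rfl
  · exact append_lt_append_of_length hx.1.length_eq.symm h _ _
  · exact (append_lt_append_left_iff a).2 hy.2

theorem ge_mul_ge {a b : List X} {f g : FreeAlgebra k X} (hf : f ∈ geSpan k a)
    (hg : g ∈ geSpan k b) : f * g ∈ geSpan k (a ++ b) := by
  have h := Submodule.mul_mem_mul hf hg
  rw [geSpan, geSpan, Submodule.span_mul_span] at h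
  refine Submodule.span_mono ?_ h
  rintro _ ⟨_, ⟨x, hx, rfl⟩, _, ⟨y, hy, rfl⟩, rfl⟩
  exact ⟨x ++ y, ⟨hx.1.append hy.1, append_le_append_of_length hx.1.length_eq.symm hx.2 hy.2⟩,
    wordElem_append k x y⟩

theorem mul_sub_mem {a b : List X} {f g : FreeAlgebra k X} (hf : f - wordElem k a ∈ gtSpan k a)
    (hg : g - wordElem k b ∈ gtSpan k b) : f * g - wordElem k (a ++ b) ∈ gtSpan k (a ++ b) := by
  have h1 := gt_mul_ge hf (mem_geSpan_of_sub hg)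
  have h2 := ge_mul_gt (wordElem_mem_geSpan (k := k) a) hg
  have h3 := (gtSpan k (a ++ b)).add_mem h1 h2
  rw [wordElem_append]
  convert h3 using 1
  noncomm_ring

theorem lyndonBracket_sub_mem (w : List X) (hw : IsLyndon w) :
    lyndonBracket (FreeAlgebra.ι k) w - wordElem k w ∈ gtSpan k w := by
  induction hn : w.length using Nat.strong_induction_on generalizing w with
  | _ n ih =>
    subst hn
    rw [lyndonBracket]
    by_cases h2 : 2 ≤ w.length
    · obtain ⟨h0, h1, hL, hR⟩ := standardCut_spec hw h2
      rw [dif_pos ⟨h0, h1⟩]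
      set i := standardCut w
      have hl := ih (w.take i).length (by rw [List.length_take]; omega) _ hL rfl
      have hr := ih (w.drop i).length (by rw [List.length_drop]; omega) _ hR rfl
      have e : w.take i ++ w.drop i = w := List.take_append_drop i w
      have m1 := mul_sub_mem hl hr
      rw [e] at m1
      have m2 := ge_mul_ge (mem_geSpan_of_sub hr) (mem_geSpan_of_sub hl)
      have m3 : geSpan k (w.drop i ++ w.take i) ≤ gtSpan k w := by
        refine Submodule.span_mono (Set.image_mono fun z hz => ⟨?_, ?_⟩)
        · exact hz.1.trans (List.perm_append_comm.trans (by rw [e]))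
        · exact (hw.2 _ _ hL.1 hR.1 e.symm).trans_le hz.2
      have m4 := (gtSpan k w).sub_mem m1 (m3 m2)
      convert m4 using 1
      abel
    · rw [dif_neg (by omega)]
      simp [wordElem]

theorem pbwMonomial_sub_mem (w : List X) :
    pbwMonomial (FreeAlgebra.ι k) w - wordElem k w ∈ gtSpan k w := by
  have key : ∀ l : List (List X), (∀ u ∈ l, IsLyndon u) →
      (l.map (lyndonBracket (FreeAlgebra.ι k))).prod - wordElem k l.flatten
        ∈ gtSpan k l.flatten := by
    intro l hl
    induction l with
    | nil => simp [wordElem]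
    | cons a l ih =>
      rw [List.map_cons, List.prod_cons, List.flatten_cons]
      exact mul_sub_mem (lyndonBracket_sub_mem a (hl a (by simp)))
        (ih fun u hu => hl u (List.mem_cons_of_mem _ hu))
  obtain ⟨h1, -, h3⟩ := lyndonFactorization_spec w
  have := key _ h1
  rwa [h3] at this

theorem repr_eq_zero_of_mem_gtSpan {w z : List X} (hz : z ≤ w) {f : FreeAlgebra k X}
    (hf : f ∈ gtSpan k w) :
    (FreeAlgebra.basisFreeMonoid k X).repr f (FreeMonoid.ofList z) = 0 := by
  induction hf using Submodule.span_induction with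
  | mem x hx =>
    obtain ⟨y, hy, rfl⟩ := hx
    rw [← basisFreeMonoid_apply, Module.Basis.repr_self, Finsupp.single_eq_of_ne]
    intro h
    have h' : z = y := h
    exact absurd hz (not_le.2 (h' ▸ hy.2))
  | zero => simp
  | add x y _ _ hx hy => simp [hx, hy]
  | smul c x _ hx => simp [hx]

theorem repr_pbwMonomial (w z : List X) (hz : z ≤ w) :
    (FreeAlgebra.basisFreeMonoid k X).repr (pbwMonomial (FreeAlgebra.ι k) w)
      (FreeMonoid.ofList z) = if w = z then 1 else 0 := by
  have h := repr_eq_zero_of_mem_gtSpan hz (pbwMonomial_sub_mem (k := k) w)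
  rw [map_sub, Finsupp.sub_apply, sub_eq_zero] at h
  rw [h, ← basisFreeMonoid_apply, Module.Basis.repr_self]
  split_ifs with hwz
  · rw [hwz, Finsupp.single_eq_same]
  · exact Finsupp.single_eq_of_ne fun hh => hwz (FreeMonoid.ofList.injective hh).symm

theorem pbwMonomial_linearIndependent :
    LinearIndependent k (pbwMonomial (X := X) (FreeAlgebra.ι k)) := by
  rw [linearIndependent_iff]
  intro c hc
  by_contra hne
  have hs : c.support.Nonempty := Finsupp.support_nonempty_iff.2 hne
  have hz := c.support.min'_mem hs
  have hmin : ∀ w ∈ c.support, c.support.min' hs ≤ w := fun w hw => c.support.min'_le w hw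
  generalize c.support.min' hs = z at hz hmin
  have h := congrArg
    (fun f => (FreeAlgebra.basisFreeMonoid k X).repr f (FreeMonoid.ofList z)) hc
  simp only [Finsupp.linearCombination_apply, Finsupp.sum, map_sum, map_smul, map_zero,
    Finsupp.coe_finsetSum, Finset.sum_apply, Finsupp.smul_apply, Finsupp.coe_zero,
    Pi.zero_apply] at h
  rw [Finset.sum_congr rfl fun w hw => by rw [repr_pbwMonomial w z (hmin w hw)]] at h
  simp [Finsupp.mem_support_iff.1 hz] at h

theorem wordElem_mem_span (w : List X) :
    wordElem k w ∈ Submodule.span k (Set.range (pbwMonomial (X := X) (FreeAlgebra.ι k))) := by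
  have hfin : ∀ w : List X, {z : List X | z.Perm w ∧ w < z}.Finite := fun w =>
    (List.finite_toSet w.permutations).subset fun z hz => List.mem_permutations.2 hz.1
  induction hn : {z : List X | z.Perm w ∧ w < z}.ncard using Nat.strong_induction_on
    generalizing w with
  | _ n ih =>
    subst hn
    have hle : gtSpan k w ≤
        Submodule.span k (Set.range (pbwMonomial (X := X) (FreeAlgebra.ι k))) := by
      rw [gtSpan, Submodule.span_le]
      rintro _ ⟨z, hz, rfl⟩
      refine ih _ (Set.ncard_lt_ncard ?_ (hfin w)) z rfl
      refine ⟨fun y hy => ⟨hy.1.trans hz.1, hz.2.trans hy.2⟩, fun hsub => ?_⟩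
      exact lt_irrefl _ (hsub hz).2
    have h1 := hle (pbwMonomial_sub_mem (k := k) w)
    have h2 := Submodule.subset_span (R := k) (Set.mem_range_self (f := pbwMonomial (X := X)
      (FreeAlgebra.ι k)) w)
    have := Submodule.sub_mem _ h2 h1
    simpa using this

theorem pbwMonomial_span :
    ⊤ ≤ Submodule.span k (Set.range (pbwMonomial (X := X) (FreeAlgebra.ι k))) := by
  rw [← (FreeAlgebra.basisFreeMonoid k X).span_eq, Submodule.span_le]
  rintro _ ⟨w, rfl⟩
  exact (basisFreeMonoid_apply k (FreeMonoid.toList w)) ▸ wordElem_mem_span _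

/-- The Poincaré-Birkhoff-Witt basis of the free algebra given by the Lyndon-Shirshov basis. -/
noncomputable def pbwBasis (k : Type v) [Field k] (X : Type u) [LinearOrder X] :
    Module.Basis (List X) k (FreeAlgebra k X) :=
  Module.Basis.mk pbwMonomial_linearIndependent pbwMonomial_span

theorem pbwBasis_apply (w : List X) : pbwBasis k X w = pbwMonomial (FreeAlgebra.ι k) w := by
  simp [pbwBasis]

end Basis

/-- The letter `1` of the alphabet `{1 < 2}`. -/
abbrev letter1 : Fin 2 := 0

/-- The letter `2` of the alphabet `{1 < 2}`. -/
abbrev letter2 : Fin 2 := 1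

/-- The shuffle type polynomial `SH_{i,j}(y, x)`: the sum of all words in `(x + y)^(i + j)` with
`i` letters `y` and `j` letters `x`. -/
def shufflePoly {A : Type v} [Semiring A] (i j : ℕ) (y x : A) : A :=
  ∑ b : Fin (i + j) → Bool with (List.ofFn b).count true = i,
    ((List.ofFn b).map fun c => if c then y else x).prod

/-- The coefficient `C_{E_α}` of `E_α` in `SH_{α(2), α(1)}(E_2, E_1)` with respect to the
Poincaré-Birkhoff-Witt basis. For a word `α` that is not Lyndon, `E_α` stands for the basis element
`pbwMonomial`, e.g. `E_1 ^ s` for the word `1 ⋯ 1` of length `s`. -/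
noncomputable def lyndonCoeff (k : Type v) [Field k] (α : List (Fin 2)) : k :=
  (pbwBasis k (Fin 2)).repr
    (shufflePoly (α.count letter2) (α.count letter1)
      (FreeAlgebra.ι k letter2) (FreeAlgebra.ι k letter1)) α

open scoped Classical in
/-- The finite set of Lyndon words of length `n` in the letters `1 < 2`. -/
noncomputable def lyndonWords (n : ℕ) : Finset (List (Fin 2)) :=
  (Finset.univ.image fun f : Fin n → Fin 2 => List.ofFn f).filter IsLyndon

theorem mem_lyndonWords {n : ℕ} {α : List (Fin 2)} :
    α ∈ lyndonWords n ↔ α.length = n ∧ IsLyndon α := by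
  simp only [lyndonWords, Finset.mem_filter, Finset.mem_image, Finset.mem_univ, true_and,
    and_congr_left_iff]
  intro _
  constructor
  · rintro ⟨f, rfl⟩
    simp
  · rintro rfl
    exact ⟨α.get, List.ofFn_get α⟩

end LyndonShirshov

/-! Part (b) is Jacobson's argument. With `u = E₂ X + E₁` and `X` central, `SH_{i,p-i}(E₂, E₁)` is
the coefficient of `X ^ i` in `u ^ p`. The derivative of `u ^ p` is the sum of all `u ^ m * E₂ * u ^
(p - 1 - m)`, and in characteristic `p` this is `(ad u)^(p-1) E₂`, because `(p-1).choose m = (-1) ^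
m` (`iterate_lie_pred_prime`). Comparing coefficients of `X ^ (i - 1)`, `i • SH_{i,p-i}` is a sum of
iterated commutators of letters, and `i` is invertible for `0 < i < p`.

The span of the `E_α` is closed under commutators, with control of the content
(`lie_lyndonBracket_mem`). So `SH_{i,p-i}` is a combination of `E_α` with `α` Lyndon of the right
content (`shufflePoly_mem_lyndonSpan`). These are vectors of the Poincaré-Birkhoff-Witt basis, so no
other basis vector occurs in the expansion.

For (a), a basis monomial is its word plus larger rearrangements. At the word `1^s 2^t`, least among
its rearrangements, the basis coordinate is therefore the plain coefficient of that word, which is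
`1`.

For (c), (b) is mapped from the free algebra to `A`. Only one Lyndon word of length `p` has a single
letter `1`, and only one has a single letter `2`; by (a) their coefficients are `1`. -/

namespace LyndonShirshov

universe u v

attribute [local instance] LieRing.ofAssociativeRing

/-! ### Standard factorization via the least proper suffix -/

section StandardFactorization

variable {X : Type u} [LinearOrder X]

/-- A Lyndon word all of whose nonempty proper right factors are at least its Lyndon right factor `b`
has standard factorization `(a, b)`. -/
theorem standardCut_append {a b : List X} (ha : IsLyndon a) (hb : IsLyndon b)
    (h : ∀ c d : List X, c ≠ [] → d ≠ [] → a ++ b = c ++ d → b ≤ d) :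
    standardCut (a ++ b) = a.length := by
  have ha0 := List.length_pos_iff.2 ha.1
  have hb0 := List.length_pos_iff.2 hb.1
  refine IsLeast.csInf_eq ⟨⟨ha0, by simpa using hb0, by simpa using ha, by simpa using hb⟩, ?_⟩
  rintro i ⟨h1, h2, -, h4⟩
  by_contra hlt
  rw [not_le] at hlt
  rw [List.drop_append_of_le_length hlt.le] at h4
  have h5 : a.drop i ≠ [] := by simpa using hlt
  -- A longer Lyndon right factor would have `b` as a proper suffix and so be smaller than `b`,
  -- against minimality.
  refine absurd (h4.lt_suffix h5 hb.1 rfl) (not_lt.2 (h (a.take i) _ ?_ h4.1 ?_))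
  · have : a.take i ≠ [] := by
      rw [ne_eq, List.take_eq_nil_iff]
      rintro (h | h)
      · omega
      · exact ha.1 h
    exact this
  · rw [← List.append_assoc, List.take_append_drop]

/-- A Lyndon word that is not a letter is the product of two Lyndon words, the second of which is
its least nonempty proper right factor. -/
theorem exists_min_suffix {w : List X} (hw : IsLyndon w) (h2 : 2 ≤ w.length) :
    ∃ a b : List X, a ++ b = w ∧ IsLyndon a ∧ IsLyndon b ∧
      ∀ c d : List X, c ≠ [] → d ≠ [] → a ++ b = c ++ d → b ≤ d := by
  obtain ⟨i, hi, hmin⟩ := Finset.exists_min_image (Finset.Ioo 0 w.length) (fun i => w.drop i)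
    ⟨1, by simp; omega⟩
  rw [Finset.mem_Ioo] at hi
  have key : ∀ c d : List X, c ≠ [] → d ≠ [] → w = c ++ d → w.drop i ≤ d := by
    intro c d hc hd e
    have hc0 := List.length_pos_iff.2 hc
    have hd0 := List.length_pos_iff.2 hd
    have := hmin c.length (by rw [Finset.mem_Ioo, e, List.length_append]; omega)
    rw [e] at this ⊢
    simpa using this
  have e : w.take i ++ w.drop i = w := List.take_append_drop i w
  have ht0 : w.take i ≠ [] := by
    rw [ne_eq, List.take_eq_nil_iff]
    rintro (h | h)
    · omega
    · exact hw.1 h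
  have hd0 : w.drop i ≠ [] := by simpa using hi.2
  have hb : IsLyndon (w.drop i) := by
    refine isLyndon_of_lt_suffix hd0 fun c d hc hd h => ?_
    refine lt_of_le_of_ne (key (w.take i ++ c) d (by simp [hc]) hd ?_) ?_
    · rw [List.append_assoc, ← h, e]
    · intro h'
      have := congrArg List.length h
      rw [List.length_append, ← h'] at this
      exact hc (List.length_eq_zero_iff.1 (by omega))
  refine ⟨w.take i, w.drop i, e, isLyndon_of_lt_suffix ht0 fun c d hc hd h => ?_, hb, ?_⟩
  -- Suppose a proper suffix `d` of the left factor is at most that factor. If `d` is a prefix of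
  -- it, with rest `r`, cancelling `d` in `w < d ++ w.drop i` makes `r ++ w.drop i` a suffix below
  -- the least one. If not, `d ++ w.drop i < w`, against `w` being Lyndon.
  · by_contra hlt
    have e' : w = c ++ (d ++ w.drop i) := by rw [← List.append_assoc, ← h, e]
    have hw' : w < d ++ w.drop i := hw.lt_suffix hc (by simp [hd]) e'
    by_cases hp : d <+: w.take i
    · obtain ⟨r, hr⟩ := hp
      have hr0 : r ≠ [] := by
        rintro rfl
        rw [List.append_nil] at hr
        rw [← hr] at h
        have := congrArg List.length h
        rw [List.length_append] at this
        exact hc (List.length_eq_zero_iff.1 (by omega))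
      have e2 : w = d ++ (r ++ w.drop i) := by rw [← List.append_assoc, hr, e]
      have h3 : r ++ w.drop i < w.drop i := by
        rwa [← append_lt_append_left_iff d, ← e2]
      exact absurd (key d _ hd (by simp [hr0]) e2) (not_le.2 h3)
    · have hne : d ≠ w.take i := fun h' => hp (h' ▸ List.prefix_rfl)
      have := append_lt_append_of_lt (lt_of_le_of_ne (not_lt.1 hlt) hne) hp (w.drop i) (w.drop i)
      rw [e] at this
      exact lt_asymm hw' this
  · rwa [e]

variable {A : Type v} [Ring A] (e : X → A)

theorem lyndonBracket_singleton (x : X) : lyndonBracket e [x] = e x := by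
  rw [lyndonBracket, dif_neg]
  · simp
  · rintro ⟨h1, h2⟩
    simp at h2
    omega

theorem lyndonBracket_append {a b : List X} (ha : IsLyndon a) (hb : IsLyndon b)
    (h : ∀ c d : List X, c ≠ [] → d ≠ [] → a ++ b = c ++ d → b ≤ d) :
    lyndonBracket e (a ++ b) = ⁅lyndonBracket e a, lyndonBracket e b⁆ := by
  rw [lyndonBracket, standardCut_append ha hb h, dif_pos]
  · rw [List.take_left, List.drop_left, Ring.lie_def]
  · exact ⟨List.length_pos_iff.2 ha.1, by simpa using List.length_pos_iff.2 hb.1⟩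

theorem map_lyndonBracket {B F : Type*} [Ring B] [FunLike F A B] [RingHomClass F A B] (f : F)
    (w : List X) : f (lyndonBracket e w) = lyndonBracket (fun x => f (e x)) w := by
  induction hn : w.length using Nat.strong_induction_on generalizing w with
  | _ n ih =>
    subst hn
    rw [lyndonBracket.eq_1 e w, lyndonBracket.eq_1 _ w]
    split_ifs with h
    · rw [map_sub, map_mul, map_mul, ih _ _ _ rfl, ih _ _ _ rfl]
      · rw [List.length_drop]
        omega
      · rw [List.length_take]
        omega
    · rw [map_list_prod, List.map_map]
      rfl

end StandardFactorization

/-! ### Closure of the span of the `E_α` under commutators -/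

section LieClosed

variable {X : Type u} [LinearOrder X] (k : Type*) [CommRing k] {A : Type v} [Ring A] [Algebra k A]
  (e : X → A)

/-- The span of the elements `E_c`, for the Lyndon words `c` that are rearrangements of `w` and
smaller than `b`. -/
noncomputable def lyndonSpanLT (w b : List X) : Submodule k A :=
  Submodule.span k (lyndonBracket e '' {c | IsLyndon c ∧ c.Perm w ∧ c < b})

variable {k}

theorem lie_mem_of_mem_span {s : Set A} {T : Submodule k A} {x f : A}
    (h : ∀ g ∈ s, ⁅x, g⁆ ∈ T) (hf : f ∈ Submodule.span k s) : ⁅x, f⁆ ∈ T := by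
  induction hf using Submodule.span_induction with
  | mem g hg => exact h g hg
  | zero => simp
  | add f g _ _ hf hg => rw [lie_add]; exact T.add_mem hf hg
  | smul c f _ hf => rw [lie_smul]; exact T.smul_mem c hf

/-- If `(a, b)` is the standard factorization of `a ++ b`, the commutator is `E_{ab}`. Otherwise `a`
is itself split and the Jacobi identity applies. The bound `c < b` in `lyndonSpanLT` keeps the
induction going: the outer brackets that remain have the same total length, but both words lie below
`b`. -/
theorem lie_lyndonBracket_mem [Finite X] {a b : List X} (ha : IsLyndon a) (hb : IsLyndon b)
    (hab : a < b) :
    ⁅lyndonBracket e a, lyndonBracket e b⁆ ∈ lyndonSpanLT k e (a ++ b) b := by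
  induction hn : (a ++ b).length using Nat.strong_induction_on generalizing a b with
  | _ n ihn =>
  -- The inner induction, at fixed total length, is on the number of words of length at most `n`
  -- below `b`; it is finite because the alphabet is.
  have hfin : ∀ b : List X, {c : List X | c.length ≤ n ∧ c < b}.Finite := fun b =>
    (List.finite_length_le X n).subset fun c hc => hc.1
  induction hm : {c : List X | c.length ≤ n ∧ c < b}.ncard using Nat.strong_induction_on
    generalizing a b with
  | _ m ihm =>
  subst hm
  by_cases hmin : ∀ c d : List X, c ≠ [] → d ≠ [] → a ++ b = c ++ d → b ≤ d
  · rw [← lyndonBracket_append e ha hb hmin]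
    exact Submodule.subset_span ⟨a ++ b, ⟨ha.append hb hab, List.Perm.refl _,
      (ha.append hb hab).lt_suffix ha.1 hb.1 rfl⟩, rfl⟩
  -- smaller pairs of the same total length, in either order
  have same : ∀ w u v : List X, IsLyndon u → IsLyndon v → (u ++ v).Perm w → w.length = n →
      u < b → v < b → ⁅lyndonBracket e u, lyndonBracket e v⁆ ∈ lyndonSpanLT k e w b := by
    have aux : ∀ w u v : List X, IsLyndon u → IsLyndon v → (u ++ v).Perm w → w.length = n →
        u < v → v < b → ⁅lyndonBracket e u, lyndonBracket e v⁆ ∈ lyndonSpanLT k e w b := by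
      intro w u v hu hv hw hwn huv hvb
      have hl : (u ++ v).length = n := hw.length_eq.trans hwn
      have hss : {c : List X | c.length ≤ n ∧ c < v} ⊂ {c | c.length ≤ n ∧ c < b} := by
        refine ⟨fun c hc => ⟨hc.1, hc.2.trans hvb⟩, fun hsub => lt_irrefl v ?_⟩
        exact (hsub (a := v) ⟨by rw [← hl]; simp, hvb⟩).2
      have := ihm _ (Set.ncard_lt_ncard hss (hfin b)) hu hv huv hl rfl
      refine Submodule.span_mono (Set.image_mono ?_) this
      exact fun c hc => ⟨hc.1, hc.2.1.trans hw, hc.2.2.trans hvb⟩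
    intro w u v hu hv hw hwn hub hvb
    rcases lt_trichotomy u v with h | rfl | h
    · exact aux w u v hu hv hw hwn h hvb
    · rw [lie_self]
      exact Submodule.zero_mem _
    · rw [← lie_skew]
      exact Submodule.neg_mem _ (aux w v u hv hu (List.perm_append_comm.trans hw) hwn h hub)
  push Not at hmin
  obtain ⟨c, d, hc, hd, hcd, hdb⟩ := hmin
  -- Proper suffixes of the Lyndon word `b` exceed `b`, so a suffix of `a ++ b` below `b` must reach
  -- into `a`.
  obtain ⟨s, hs0, hs, rfl⟩ : ∃ s, s ≠ [] ∧ a = c ++ s ∧ d = s ++ b := by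
    rcases List.append_eq_append_iff.1 hcd with ⟨t, h1, h2⟩ | ⟨t, h1, h2⟩
    · by_cases ht : t = []
      · rw [ht, List.nil_append] at h2
        exact absurd hdb (h2 ▸ lt_irrefl _)
      · exact absurd (hb.lt_suffix ht hd h2) (not_lt.2 hdb.le)
    · refine ⟨t, ?_, h1, h2⟩
      rintro rfl
      rw [h2, List.nil_append] at hdb
      exact lt_irrefl _ hdb
  have ha2 : 2 ≤ a.length := by
    have h1 := List.length_pos_iff.2 hc
    have h2 := List.length_pos_iff.2 hs0
    rw [hs, List.length_append]
    omega
  obtain ⟨a₁, a₂, rfl, h1, h2, hmin⟩ := exists_min_suffix ha ha2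
  -- As `a₂` is the least proper suffix of `a`: `a₂ ≤ s < s ++ b < b`.
  have h2b : a₂ < b := (hmin c s hc hs0 hs).trans_lt ((lt_append_right s hb.1).trans hdb)
  have h12 : a₁ < a₂ := (lt_append_right a₁ h2.1).trans (ha.lt_suffix h1.1 h2.1 rfl)
  have l1 := List.length_pos_iff.2 h1.1
  have l2 := List.length_pos_iff.2 h2.1
  simp only [List.length_append] at hn
  -- `[[a₁, a₂], b] = [a₁, [a₂, b]] - [a₂, [a₁, b]]`. The inner brackets are shorter and yield words
  -- below `b`; the outer ones are then covered by `same`.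
  rw [lyndonBracket_append e h1 h2 hmin, lie_lie]
  refine Submodule.sub_mem _ ?_ ?_
  · refine lie_mem_of_mem_span ?_ (ihn _ ?_ h2 hb h2b rfl)
    · rintro _ ⟨g, hg, rfl⟩
      refine same _ _ _ h1 hg.1 ?_ ?_ (h12.trans h2b) hg.2.2
      · rw [List.append_assoc]
        exact hg.2.1.append_left a₁
      · simp only [List.length_append]
        omega
    · simp only [List.length_append]
      omega
  · refine lie_mem_of_mem_span ?_ (ihn _ ?_ h1 hb (h12.trans h2b) rfl)
    · rintro _ ⟨g, hg, rfl⟩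
      refine same _ _ _ h2 hg.1 ?_ ?_ h2b hg.2.2
      · refine (hg.2.1.append_left a₂).trans ?_
        rw [← List.append_assoc]
        exact List.perm_append_comm.append_right b
      · simp only [List.length_append]
        omega
    · simp only [List.length_append]
      omega

end LieClosed

/-! ### Shuffle type polynomials as coefficients of a power of a linear polynomial -/

section Shuffle

open Polynomial

variable {A : Type v}

theorem add_pow_eq_sum_words [Semiring A] (a b : A) (n : ℕ) :
    (a + b) ^ n =
      ∑ f : Fin n → Bool, ((List.ofFn f).map fun c => if c then a else b).prod := by
  induction n with
  | zero => simp
  | succ n ih =>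
    rw [pow_succ', ih, ← (Fin.consEquiv fun _ => Bool).sum_comp, Fintype.sum_prod_type,
      Fintype.sum_bool, add_mul, Finset.mul_sum, Finset.mul_sum]
    simp [Fin.consEquiv, List.ofFn_succ]

theorem shufflePoly_eq_sum [Semiring A] {i j n : ℕ} (h : i + j = n) (y x : A) :
    shufflePoly i j y x = ∑ f : Fin n → Bool with (List.ofFn f).count true = i,
      ((List.ofFn f).map fun c => if c then y else x).prod := by
  subst h
  rfl

theorem add_pow_eq_sum_shufflePoly [Semiring A] (y x : A) (n : ℕ) :
    (y + x) ^ n = ∑ i ∈ Finset.range (n + 1), shufflePoly i (n - i) y x := by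
  rw [add_pow_eq_sum_words, ← Finset.sum_fiberwise_of_maps_to (t := Finset.range (n + 1))
    (g := fun f : Fin n → Bool => (List.ofFn f).count true)]
  · refine Finset.sum_congr rfl fun i hi => (shufflePoly_eq_sum ?_ y x).symm
    rw [Finset.mem_range] at hi
    omega
  · intro f _
    have := (List.ofFn f).count_le_length (a := true)
    rw [List.length_ofFn] at this
    rw [Finset.mem_range]
    omega

/-- As `X` is central, each word in `y X` and `x` contributes the corresponding word in `y` and `x`,
times `X` to the number of its letters `y`. -/
theorem coeff_linear_pow [Semiring A] (y x : A) {i j n : ℕ} (h : i + j = n) :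
    ((C y * X + C x) ^ n).coeff i = shufflePoly i j y x := by
  have key : ∀ l : List Bool, (l.map fun c => if c then C y * X else C x).prod =
      C (l.map fun c => if c then y else x).prod * X ^ l.count true := by
    intro l
    induction l with
    | nil => simp
    | cons c l ih =>
      cases c
      · simp [ih, mul_assoc]
      · simp only [List.map_cons, List.prod_cons, ih, if_true, List.count_cons_self, map_mul]
        rw [mul_assoc, ← mul_assoc X, X_mul_C, mul_assoc, mul_assoc, ← pow_succ']
  rw [add_pow_eq_sum_words, shufflePoly_eq_sum h, finsetSum_coeff, Finset.sum_filter]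
  refine Finset.sum_congr rfl fun f _ => ?_
  rw [key, coeff_C_mul_X_pow]
  simp only [eq_comm]

theorem map_shufflePoly {B F : Type*} [Semiring A] [Semiring B] [FunLike F A B]
    [RingHomClass F A B] (f : F) (i j : ℕ) (y x : A) :
    f (shufflePoly i j y x) = shufflePoly i j (f y) (f x) := by
  rw [shufflePoly, shufflePoly, map_sum]
  refine Finset.sum_congr rfl fun b _ => ?_
  rw [map_list_prod, List.map_map]
  congr 2
  ext c
  cases c <;> simp

/-- The Leibniz rule over noncommutative coefficients: `u` need not commute with its derivative, so
the terms cannot be merged. -/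
theorem derivative_pow_succ_eq_sum [Semiring A] (u : A[X]) (n : ℕ) :
    derivative (u ^ (n + 1)) = ∑ m ∈ Finset.range (n + 1), u ^ m * derivative u * u ^ (n - m) := by
  induction n with
  | zero => simp
  | succ n ih =>
    rw [pow_succ, derivative_mul, ih, Finset.sum_range_succ _ (n + 1), Finset.sum_mul]
    congr 1
    · refine Finset.sum_congr rfl fun m hm => ?_
      rw [Finset.mem_range] at hm
      rw [mul_assoc, ← pow_succ]
      congr 2
      omega
    · simp

end Shuffle

/-! ### The power `(ad u)^(p-1)` in characteristic `p` -/

section Jacobson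

variable {R : Type v} [Ring R] {p : ℕ}

/-- By Pascal's rule, consecutive entries of row `p - 1` sum to an inner entry of row `p` (or, at
the end, to the next such entry while `m + 1 < p`), which `p` divides; so the signs alternate from
`1`. -/
theorem choose_pred_prime_cast (hp : p.Prime) (h0 : (p : R) = 0) {m : ℕ} (hm : m < p) :
    ((p - 1).choose m : R) = (-1) ^ m := by
  induction m with
  | zero => simp
  | succ m ih =>
    have h1 : p.choose (m + 1) = (p - 1).choose m + (p - 1).choose (m + 1) := by
      rw [← Nat.choose_succ_succ', Nat.sub_add_cancel hp.one_le]
    obtain ⟨c, hc⟩ := hp.dvd_choose_self (Nat.succ_ne_zero m) hm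
    have h2 : ((p.choose (m + 1) : ℕ) : R) = 0 := by rw [hc, Nat.cast_mul, h0, zero_mul]
    rw [h1, Nat.cast_add, ih (by omega)] at h2
    rw [pow_succ, mul_neg_one]
    exact (neg_eq_of_add_eq_zero_right h2).symm

/-- `ad u` is the difference of the commuting left and right multiplications by `u`. In the binomial
expansion, the sign of the coefficient and that of `(-r) ^ (p - 1 - m)` combine to `(-1) ^ (p - 1) =
1`. -/
theorem iterate_lie_pred_prime (hp : p.Prime) (h0 : (p : R) = 0) (u v : R) :
    (fun w => ⁅u, w⁆)^[p - 1] v = ∑ m ∈ Finset.range p, u ^ m * v * u ^ (p - 1 - m) := by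
  set l := LinearMap.mulLeft ℤ u
  set r := LinearMap.mulRight ℤ u
  have hlr : Commute l (-r) := (LinearMap.commute_mulLeft_right u u).neg_right
  have h1 : ∀ n : ℕ, (fun w => ⁅u, w⁆)^[n] v = ((l + -r) ^ n) v := by
    intro n
    induction n with
    | zero => simp
    | succ n ih =>
      rw [Function.iterate_succ_apply', ih, pow_succ', Module.End.mul_apply]
      simp [l, r, Ring.lie_def, sub_eq_add_neg]
  have hr : ∀ (n : ℕ) (w : R), ((-r) ^ n) w = (-1) ^ n * (w * u ^ n) := by
    intro n w
    rw [neg_pow, LinearMap.pow_mulRight]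
    rcases neg_one_pow_eq_or (Module.End ℤ R) n with h | h <;>
    rcases Nat.even_or_odd n with h' | h' <;> simp [h'.neg_one_pow]
  -- Taking `m = p - 1` in the previous lemma also covers `p = 2`, where `-1 = 1`.
  have hs : ((-1 : R)) ^ (p - 1) = 1 := by
    rw [← choose_pred_prime_cast hp h0 (Nat.sub_lt hp.pos one_pos), Nat.choose_self, Nat.cast_one]
  rw [h1, hlr.add_pow, Nat.sub_add_cancel hp.one_le, LinearMap.sum_apply]
  refine Finset.sum_congr rfl fun m hm => ?_
  rw [Finset.mem_range] at hm
  rw [Module.End.mul_apply, Module.End.mul_apply, Module.End.natCast_apply, map_nsmul, map_nsmul,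
    hr, LinearMap.pow_mulLeft, LinearMap.mulLeft_apply, nsmul_eq_mul, choose_pred_prime_cast hp h0 hm]
  have hc : Commute (u ^ m) ((-1 : R) ^ (p - 1 - m)) := ((Commute.one_right _).neg_right).pow_right _
  rw [← mul_assoc (u ^ m), hc.eq, mul_assoc, ← mul_assoc, ← pow_add,
    show m + (p - 1 - m) = p - 1 by omega, hs, one_mul, mul_assoc]

end Jacobson

/-! ### Shuffle type polynomials of degree `p` as combinations of the `E_α` -/

section Primitive

open Polynomial

variable (k : Type u) [Field k] {A : Type v} [Ring A] [Algebra k A] (e : Fin 2 → A)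

/-- The span of the `E_c`, for the Lyndon words `c` of length `n` with `i` letters `2`. -/
noncomputable def lyndonSpan (i n : ℕ) : Submodule k A :=
  Submodule.span k (lyndonBracket e '' {c | IsLyndon c ∧ c.count letter2 = i ∧ c.length = n})

variable {k}

theorem lie_letter_mem_lyndonSpan (x : Fin 2) {i n : ℕ} {f : A} (hf : f ∈ lyndonSpan k e i n) :
    ⁅e x, f⁆ ∈ lyndonSpan k e (i + [x].count letter2) (n + 1) := by
  refine lie_mem_of_mem_span ?_ hf
  have aux : ∀ a b w : List (Fin 2), w.count letter2 = i + [x].count letter2 → w.length = n + 1 →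
      (a ++ b).Perm w → IsLyndon a → IsLyndon b → a < b →
      ⁅lyndonBracket e a, lyndonBracket e b⁆ ∈ lyndonSpan k e (i + [x].count letter2) (n + 1) := by
    intro a b w h1 h2 hw ha hb hab
    refine Submodule.span_mono (Set.image_mono ?_) (lie_lyndonBracket_mem (k := k) e ha hb hab)
    rintro c ⟨hc, hcp, -⟩
    exact ⟨hc, by rw [(hcp.trans hw).count_eq, h1], by rw [(hcp.trans hw).length_eq, h2]⟩
  rintro _ ⟨g, ⟨hg, h1, h2⟩, rfl⟩
  have hc : ([x] ++ g).count letter2 = i + [x].count letter2 := by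
    rw [List.count_append, h1, add_comm]
  have hl : ([x] ++ g).length = n + 1 := by simp [h2]
  rw [← lyndonBracket_singleton e x]
  rcases lt_trichotomy [x] g with h | rfl | h
  · exact aux _ _ _ hc hl (List.Perm.refl _) (isLyndon_singleton x) hg h
  · rw [lie_self]
    exact Submodule.zero_mem _
  · rw [← lie_skew]
    exact Submodule.neg_mem _ (aux _ _ _ hc hl List.perm_append_comm hg (isLyndon_singleton x) h)

/-- The exponent of `X` counts the letters `2` contributed by the brackets; the initial `E₂`
accounts for both shifts by one. -/
theorem coeff_iterate_lie_mem (n m : ℕ) :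
    ((fun w => ⁅C (e letter2) * X + C (e letter1), w⁆)^[n] (C (e letter2))).coeff m
      ∈ lyndonSpan k e (m + 1) (n + 1) := by
  induction n generalizing m with
  | zero =>
    rw [Function.iterate_zero_apply, coeff_C]
    split_ifs with h
    · subst h
      exact Submodule.subset_span ⟨[letter2], ⟨isLyndon_singleton _, by simp, by simp⟩,
        lyndonBracket_singleton e _⟩
    · exact Submodule.zero_mem _
  | succ n ih =>
    rw [Function.iterate_succ_apply']
    generalize (fun w => ⁅C (e letter2) * X + C (e letter1), w⁆)^[n] (C (e letter2)) = q at ih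
    have h1 := lie_letter_mem_lyndonSpan e letter1 (ih m)
    have hc1 : [letter1].count letter2 = 0 := by decide
    have hc2 : [letter2].count letter2 = 1 := by decide
    rw [hc1, add_zero, Ring.lie_def] at h1
    rw [Ring.lie_def, add_mul, mul_add, add_sub_add_comm, coeff_add]
    refine Submodule.add_mem _ ?_ (by simpa using h1)
    -- Moving the central `X` to the right turns this part into `[E₂, q] X`: its constant
    -- coefficient vanishes, and the others shift by one.
    rw [mul_assoc, X_mul, ← mul_assoc, ← mul_assoc]
    cases m with
    | zero => simp
    | succ m =>
      have h2 := lie_letter_mem_lyndonSpan e letter2 (ih m)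
      rw [hc2, Ring.lie_def] at h2
      simpa using h2

/-- In characteristic `p`, the shuffle type polynomials of degree `p` are Lie polynomials. -/
theorem shufflePoly_mem_lyndonSpan {p : ℕ} (hp : p.Prime) [CharP k p] {i : ℕ} (h1 : 1 ≤ i)
    (hi : i ≤ p - 1) :
    shufflePoly i (p - i) (e letter2) (e letter1) ∈ lyndonSpan k e i p := by
  have hA : (p : A[X]) = 0 := by
    rw [← Polynomial.C_eq_natCast, ← map_natCast (algebraMap k A), CharP.cast_eq_zero, map_zero,
      map_zero]
  have hp2 := hp.two_le
  have key := derivative_pow_succ_eq_sum (C (e letter2) * X + C (e letter1)) (p - 1)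
  have hd : derivative (C (e letter2) * X + C (e letter1)) = C (e letter2) := by simp
  rw [hd, Nat.sub_add_cancel hp.one_le, ← iterate_lie_pred_prime hp hA] at key
  have h := coeff_iterate_lie_mem (k := k) e (p - 1) (i - 1)
  -- The coefficient of `X ^ (i - 1)` in the derivative of `u ^ p` is `SH_{i,p-i}` times `i`.
  rw [← key, coeff_derivative, Nat.sub_add_cancel h1, Nat.sub_add_cancel hp.one_le,
    coeff_linear_pow _ _ (show i + (p - i) = p by omega), ← Nat.cast_succ,
    Nat.succ_eq_add_one, Nat.sub_add_cancel h1] at h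
  have hi0 : (i : k) ≠ 0 := by
    rw [ne_eq, CharP.cast_eq_zero_iff k p]
    exact Nat.not_dvd_of_pos_of_lt h1 (by omega)
  have h' := Submodule.smul_mem _ (i : k)⁻¹ h
  rwa [← map_natCast (algebraMap k A), ← Algebra.commutes, ← Algebra.smul_def, smul_smul,
    inv_mul_cancel₀ hi0, one_smul] at h'

end Primitive

/-! ### Coefficients at words least among their rearrangements -/

section Coefficients

variable {k : Type u} [Field k]

/-- At a word `z` that is least among its rearrangements, the coordinate with respect to the
Poincaré-Birkhoff-Witt basis is the coefficient of the word `z`. -/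
theorem pbwBasis_repr_of_least {X : Type v} [LinearOrder X] {z : List X}
    (hz : ∀ w : List X, w.Perm z → z ≤ w) (f : FreeAlgebra k X) :
    (pbwBasis k X).repr f z = (FreeAlgebra.basisFreeMonoid k X).repr f (FreeMonoid.ofList z) := by
  -- Both coordinate functionals are compared on the basis monomials. For rearrangements of `z` this
  -- is triangularity; any other monomial involves only words of its own content, so both vanish.
  suffices (pbwBasis k X).coord z =
      (FreeAlgebra.basisFreeMonoid k X).coord (FreeMonoid.ofList z) from
    LinearMap.congr_fun this f
  refine (pbwBasis k X).ext fun w => ?_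
  rw [Module.Basis.coord_apply, Module.Basis.repr_self, Module.Basis.coord_apply, pbwBasis_apply]
  by_cases hw : w.Perm z
  · rw [repr_pbwMonomial w z (hz w hw), Finsupp.single_apply]
  · have hwz : w ≠ z := fun h => hw (h ▸ List.Perm.refl _)
    rw [Finsupp.single_eq_of_ne hwz.symm]
    have h := mem_geSpan_of_sub (pbwMonomial_sub_mem (k := k) w)
    generalize pbwMonomial (FreeAlgebra.ι k) w = g at h
    symm
    induction h using Submodule.span_induction with
    | mem g hg =>
      obtain ⟨y, hy, rfl⟩ := hg
      rw [← basisFreeMonoid_apply, Module.Basis.repr_self, Finsupp.single_eq_of_ne]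
      intro h
      have h' : z = y := h
      exact hw (h' ▸ hy.1.symm)
    | zero => simp
    | add f g _ _ hf hg => simp [hf, hg]
    | smul c g _ hg => simp [hg]

/-- The coefficient of a word in the shuffle type polynomial of the same content is `1`. -/
theorem repr_shufflePoly_self (w : List (Fin 2)) :
    (FreeAlgebra.basisFreeMonoid k (Fin 2)).repr
      (shufflePoly (w.count letter2) (w.count letter1)
        (FreeAlgebra.ι k letter2) (FreeAlgebra.ι k letter1)) (FreeMonoid.ofList w) = 1 := by
  -- `g` translates the Boolean words indexing the sum into words in the letters; being injective,
  -- it lets exactly one summand equal `w`.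
  set g : Bool → Fin 2 := fun c => if c then letter2 else letter1 with hg
  have hginj : Function.Injective g := by decide
  obtain ⟨l, rfl⟩ : ∃ l : List Bool, l.map g = w := by
    have : Function.Surjective g := by decide
    exact (List.map_surjective_iff.2 this) w
  have h2 : (l.map g).count letter2 = l.count true :=
    List.count_map_of_injective l g hginj true
  have h1 : (l.map g).count letter1 = l.count false :=
    List.count_map_of_injective l g hginj false
  have hlen : l.count true + l.count false = l.length := List.count_true_add_count_false l
  have hword : ∀ l' : List Bool,
      (l'.map fun c => if c then FreeAlgebra.ι k letter2 else FreeAlgebra.ι k letter1).prod =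
        FreeAlgebra.basisFreeMonoid k (Fin 2) (FreeMonoid.ofList (l'.map g)) := by
    intro l'
    rw [basisFreeMonoid_apply, wordElem, List.map_map]
    congr 2
    ext c
    cases c <;> simp [hg]
  rw [h1, h2, shufflePoly_eq_sum hlen, map_sum, Finsupp.finsetSum_apply,
    Finset.sum_eq_single_of_mem l.get (by simp [List.ofFn_get])]
  · rw [hword, Module.Basis.repr_self, List.ofFn_get, Finsupp.single_eq_same]
  · intro f _ hf
    rw [hword, Module.Basis.repr_self, Finsupp.single_eq_of_ne]
    intro h
    have h' := (List.map_injective_iff.2 hginj) (FreeMonoid.ofList.injective h)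
    refine hf (List.ofFn_injective ?_)
    exact h'.symm.trans (List.ofFn_get l).symm

theorem lyndonCoeff_of_least {z : List (Fin 2)} (hz : ∀ w : List (Fin 2), w.Perm z → z ≤ w) :
    lyndonCoeff k z = 1 := by
  rw [lyndonCoeff, pbwBasis_repr_of_least hz, repr_shufflePoly_self]

theorem le_of_perm_of_pairwise {X : Type v} [LinearOrder X] {z w : List X}
    (hz : z.Pairwise (· ≤ ·)) (hw : w.Perm z) : z ≤ w := by
  induction z generalizing w with
  | nil => rw [hw.eq_nil]
  | cons x z ih =>
    rw [List.pairwise_cons] at hz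
    cases w with
    | nil => exact absurd hw.symm.eq_nil (by simp)
    | cons y w =>
      have heq : y = x → x :: z ≤ y :: w := by
        rintro rfl
        exact append_le_append_of_length (a := [y]) rfl le_rfl (ih hz.2 hw.cons_inv)
      rcases List.mem_cons.1 (hw.subset (List.mem_cons_self (a := y) (l := w))) with h | hy
      · exact heq h
      · rcases (hz.1 y hy).lt_or_eq with h | h
        · exact (List.cons_lt_cons_iff.2 (Or.inl h)).le
        · exact heq h.symm

theorem lyndonCoeff_replicate_append (s t : ℕ) :
    lyndonCoeff k (List.replicate s letter1 ++ List.replicate t letter2) = 1 := by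
  refine lyndonCoeff_of_least fun w hw => le_of_perm_of_pairwise ?_ hw
  rw [List.pairwise_append]
  refine ⟨?_, ?_, ?_⟩
  · simp [List.pairwise_replicate]
  · simp [List.pairwise_replicate]
  · intro a ha b hb
    rw [List.eq_of_mem_replicate ha]
    exact Fin.zero_le b

end Coefficients

/-! ### Lyndon words in two letters -/

section Words

theorem count_letter1_add_count_letter2 (w : List (Fin 2)) :
    w.count letter1 + w.count letter2 = w.length := by
  induction w with
  | nil => rfl
  | cons x w ih =>
    fin_cases x <;> simp at ih ⊢ <;> omega

theorem eq_replicate_of_count_eq_zero {x y : Fin 2} (hxy : x ≠ y) {w : List (Fin 2)}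
    (h : w.count x = 0) : w = List.replicate w.length y := by
  refine List.eq_replicate_of_mem fun z hz => ?_
  have : z ≠ x := fun hzx => List.count_eq_zero.1 h (hzx ▸ hz)
  omega

/-- A power of one letter, of length at least two, equals its own rotations, so it is not Lyndon. -/
theorem IsLyndon.count_pos {w : List (Fin 2)} (hw : IsLyndon w) (h2 : 2 ≤ w.length) (x : Fin 2) :
    1 ≤ w.count x := by
  by_contra h
  obtain ⟨y, hxy⟩ : ∃ y, x ≠ y := ⟨1 - x, by fin_cases x <;> decide⟩
  have e := eq_replicate_of_count_eq_zero hxy (w := w) (by omega)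
  have e' : w = List.replicate (w.length - 1) y ++ [y] := by
    rw [← List.replicate_succ', Nat.sub_add_cancel (by omega), ← e]
  have e'' : w = [y] ++ List.replicate (w.length - 1) y := by
    rw [List.singleton_append, ← List.replicate_succ, Nat.sub_add_cancel (by omega), ← e]
  have h1 := hw.2 _ _ (by simp; omega) (by simp) e'
  exact h1.ne e''

/-- If a `2` came first, the suffix starting at the `1` would be smaller than the word. -/
theorem IsLyndon.eq_of_count_letter1 {w : List (Fin 2)} (hw : IsLyndon w)
    (h : w.count letter1 = 1) : w = letter1 :: List.replicate (w.length - 1) letter2 := by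
  obtain ⟨a, b, e⟩ := List.append_of_mem (List.count_pos_iff.1 (h ▸ one_pos : 0 < w.count letter1))
  have hab : a.count letter1 = 0 ∧ b.count letter1 = 0 := by
    rw [e, List.count_append, List.count_cons_self] at h
    omega
  have hb := eq_replicate_of_count_eq_zero (by decide : letter1 ≠ letter2) hab.2
  cases a with
  | nil =>
    rw [List.nil_append] at e
    rw [e, List.length_cons, Nat.add_sub_cancel, ← hb]
  | cons x a =>
    have h1 := hw.lt_suffix (by simp) (by simp) e
    rw [e, List.cons_append, List.cons_lt_cons_iff] at h1
    have hx : x ≠ letter1 := fun hx => by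
      rw [hx] at hab
      simp at hab
    rcases h1 with h1 | h1
    · exact absurd h1 (Fin.not_lt_zero x)
    · exact absurd h1.1 hx

/-- If a `1` followed the only `2`, the word would end in `1`, and the suffix `[1]` is too small. -/
theorem IsLyndon.eq_of_count_letter2 {w : List (Fin 2)} (hw : IsLyndon w)
    (h : w.count letter2 = 1) : w = List.replicate (w.length - 1) letter1 ++ [letter2] := by
  obtain ⟨a, b, e⟩ := List.append_of_mem (List.count_pos_iff.1 (h ▸ one_pos : 0 < w.count letter2))
  have hab : a.count letter2 = 0 ∧ b.count letter2 = 0 := by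
    rw [e, List.count_append, List.count_cons_self] at h
    omega
  have ha := eq_replicate_of_count_eq_zero (by decide : letter2 ≠ letter1) hab.1
  have hb := eq_replicate_of_count_eq_zero (by decide : letter2 ≠ letter1) hab.2
  rcases Nat.eq_zero_or_pos b.length with hl | hl
  · rw [List.length_eq_zero_iff.1 hl] at e
    rw [e, List.length_append, List.length_singleton, Nat.add_sub_cancel, ← ha]
  · exfalso
    obtain ⟨m, hm⟩ := Nat.exists_eq_add_of_lt hl
    rw [zero_add] at hm
    rw [hm, List.replicate_succ'] at hb
    have h1 := hw.lt_suffix (β := a ++ letter2 :: List.replicate m letter1) (γ := [letter1])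
      (by simp) (by simp) (by rw [e, hb]; simp)
    obtain ⟨x, l, hxl⟩ := List.exists_cons_of_ne_nil hw.1
    rw [hxl, List.cons_lt_cons_iff] at h1
    rcases h1 with h1 | h1
    · exact absurd h1 (Fin.not_lt_zero x)
    · exact List.not_lt_nil _ h1.2

end Words

/-! ### Expansions in the free algebra and in arbitrary algebras -/

section Expansion

theorem shufflePoly_eq_sum_lyndonBracket (k : Type u) [Field k] {p : ℕ} [CharP k p]
    (hp : p.Prime) {i : ℕ} (h1 : 1 ≤ i) (hi : i ≤ p - 1) :
    shufflePoly i (p - i) (FreeAlgebra.ι k letter2) (FreeAlgebra.ι k letter1) =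
      ∑ α ∈ lyndonWords p with α.count letter2 = i ∧ α.count letter1 = p - i,
        lyndonCoeff k α • lyndonBracket (FreeAlgebra.ι k) α := by
  set f := shufflePoly i (p - i) (FreeAlgebra.ι k letter2) (FreeAlgebra.ι k letter1) with hf
  have hmem := shufflePoly_mem_lyndonSpan (k := k) (FreeAlgebra.ι k) hp h1 hi
  have himg : lyndonSpan k (FreeAlgebra.ι k) i p = Submodule.span k (pbwBasis k (Fin 2) ''
      {c | IsLyndon c ∧ c.count letter2 = i ∧ c.length = p}) := by
    rw [lyndonSpan]
    congr 1
    refine Set.image_congr fun c hc => ?_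
    rw [pbwBasis_apply, pbwMonomial_of_isLyndon _ hc.1]
  -- Lying in the span of some basis vectors means that the coordinates are supported on their
  -- indices.
  rw [himg, Module.Basis.mem_span_image] at hmem
  conv_lhs => rw [← (pbwBasis k (Fin 2)).linearCombination_repr f, Finsupp.linearCombination_apply]
  rw [Finsupp.sum_of_support_subset
    (s := (lyndonWords p).filter fun α => α.count letter2 = i ∧ α.count letter1 = p - i)]
  · refine Finset.sum_congr rfl fun α hα => ?_
    rw [Finset.mem_filter, mem_lyndonWords] at hα
    rw [pbwBasis_apply, pbwMonomial_of_isLyndon _ hα.1.2, lyndonCoeff, hα.2.1, hα.2.2]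
  · intro α hα
    obtain ⟨h1, h2, h3⟩ := hmem hα
    have := count_letter1_add_count_letter2 α
    rw [Finset.mem_filter, mem_lyndonWords]
    exact ⟨⟨h3, h1⟩, h2, by omega⟩
  · simp

theorem shufflePoly_zero_left {A : Type v} [Ring A] (n : ℕ) (y x : A) :
    shufflePoly 0 n y x = x ^ n := by
  rw [← coeff_linear_pow y x (zero_add n), ← Polynomial.constantCoeff_apply, map_pow]
  simp

theorem shufflePoly_zero_right {A : Type v} [Ring A] (n : ℕ) (y x : A) :
    shufflePoly n 0 y x = y ^ n := by
  rw [shufflePoly_eq_sum (add_zero n), Finset.sum_eq_single_of_mem (fun _ => true)]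
  · simp
  · simp
  · intro f hf hne
    rw [Finset.mem_filter] at hf
    refine absurd (funext fun m => ?_) hne
    have h' := List.count_eq_length.1 (hf.2.trans (List.length_ofFn (f := f)).symm)
    exact (h' (f m) (by simp)).symm

theorem add_pow_eq_shufflePoly_middle {A : Type v} [Ring A] {n : ℕ} (hn : 1 ≤ n) (x y : A) :
    (x + y) ^ n = y ^ n + ∑ i ∈ Finset.Ioo 0 n, shufflePoly i (n - i) y x + x ^ n := by
  obtain ⟨n, rfl⟩ := Nat.exists_eq_add_of_le' hn
  have e : Finset.Ioo 0 (n + 1) = Finset.Ico 1 (n + 1) := by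
    ext i
    simp [Nat.succ_le_iff]
  rw [add_comm x y, add_pow_eq_sum_shufflePoly, Finset.sum_range_succ, Finset.range_eq_Ico,
    Finset.sum_eq_sum_Ico_succ_bot (by omega), e, Nat.sub_self, Nat.sub_zero,
    shufflePoly_zero_left, shufflePoly_zero_right]
  abel

theorem add_pow_eq_sum_lyndonBracket (k : Type u) [Field k] {p : ℕ} [CharP k p]
    (hp : p.Prime) :
    (FreeAlgebra.ι k letter1 + FreeAlgebra.ι k letter2) ^ p =
      FreeAlgebra.ι k letter2 ^ p +
        ∑ α ∈ lyndonWords p, lyndonCoeff k α • lyndonBracket (FreeAlgebra.ι k) α +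
        FreeAlgebra.ι k letter1 ^ p := by
  rw [add_pow_eq_shufflePoly_middle hp.one_le, ← Finset.sum_fiberwise_of_maps_to
    (s := lyndonWords p) (t := Finset.Ioo 0 p) (g := fun α => α.count letter2)]
  · congr 2
    refine Finset.sum_congr rfl fun i hi => ?_
    rw [Finset.mem_Ioo] at hi
    rw [shufflePoly_eq_sum_lyndonBracket k hp (by omega) (by omega)]
    refine Finset.sum_congr (Finset.filter_congr fun α hα => ?_) fun _ _ => rfl
    rw [mem_lyndonWords] at hα
    have := count_letter1_add_count_letter2 α
    omega
  -- A Lyndon word of length `p ≥ 2` contains both letters, so sorting by the number of letters `2`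
  -- only meets `0 < i < p`.
  · intro α hα
    rw [mem_lyndonWords] at hα
    have h2 := hp.two_le
    have := count_letter1_add_count_letter2 α
    have := hα.2.count_pos (by omega) letter1
    have := hα.2.count_pos (by omega) letter2
    rw [Finset.mem_Ioo]
    omega

theorem shufflePoly_eq_sum_lyndonBracket_map (k : Type u) [Field k] {p : ℕ} [CharP k p] {A : Type v} [Ring A]
    [Algebra k A] (e : Fin 2 → A) (hp : p.Prime) {i : ℕ} (h1 : 1 ≤ i) (hi : i ≤ p - 1) :
    shufflePoly i (p - i) (e letter2) (e letter1) =
      ∑ α ∈ lyndonWords p with α.count letter2 = i ∧ α.count letter1 = p - i,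
        lyndonCoeff k α • lyndonBracket e α := by
  have h := congrArg (FreeAlgebra.lift k e) (shufflePoly_eq_sum_lyndonBracket k hp h1 hi)
  simpa only [map_shufflePoly, map_sum, map_smul, map_lyndonBracket, FreeAlgebra.lift_ι_apply]
    using h

theorem shufflePoly_eq_zero_of_lyndonBracket (k : Type u) [Field k] {p : ℕ} [CharP k p] {A : Type v} [Ring A]
    [Algebra k A] {e : Fin 2 → A} (hp : p.Prime) {i : ℕ} (h1 : 1 ≤ i) (hi : i ≤ p - 1)
    (h : ∀ α ∈ lyndonWords p, α.count letter2 = i → α.count letter1 = p - i →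
      lyndonBracket e α = 0) :
    shufflePoly i (p - i) (e letter2) (e letter1) = 0 := by
  rw [shufflePoly_eq_sum_lyndonBracket_map k e hp h1 hi]
  refine Finset.sum_eq_zero fun α hα => ?_
  rw [Finset.mem_filter] at hα
  rw [h α hα.1 hα.2.1 hα.2.2, smul_zero]

/-- Built from `12` by appending letters `2` on the right, then letters `1` on the left; each step
joins two Lyndon words in increasing order. -/
theorem isLyndon_replicate_append {s t : ℕ} (hs : 1 ≤ s) (ht : 1 ≤ t) :
    IsLyndon (List.replicate s letter1 ++ List.replicate t letter2) := by
  induction s, hs using Nat.le_induction with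
  | base =>
    induction t, ht using Nat.le_induction with
    | base => exact (isLyndon_singleton letter1).append (isLyndon_singleton letter2) (by decide)
    | succ t _ ih =>
      rw [List.replicate_succ' (n := t), ← List.append_assoc]
      refine ih.append (isLyndon_singleton letter2) ?_
      rw [List.replicate_one, List.singleton_append, List.cons_lt_cons_iff]
      exact Or.inl (by decide)
  | succ s hs ih =>
    rw [List.replicate_succ, List.cons_append, ← List.singleton_append]
    refine (isLyndon_singleton letter1).append ih ?_
    obtain ⟨m, rfl⟩ := Nat.exists_eq_add_of_le' hs
    rw [List.replicate_succ, List.cons_append, List.cons_lt_cons_iff]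
    refine Or.inr ⟨rfl, ?_⟩
    cases m <;> obtain ⟨n, rfl⟩ := Nat.exists_eq_add_of_le' ht <;> simp [List.replicate_succ]

/-- If only one Lyndon word of length `p` has `i` letters `2`, and it has coefficient `1`, the shuffle
type polynomial is its bracketing. -/
theorem shufflePoly_eq_lyndonBracket (k : Type u) [Field k] {p : ℕ} [CharP k p] {A : Type v} [Ring A]
    [Algebra k A] (e : Fin 2 → A) (hp : p.Prime) {i : ℕ} (h1 : 1 ≤ i) (hi : i ≤ p - 1)
    (h : ∀ α : List (Fin 2), IsLyndon α → α.length = p → α.count letter2 = i →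
      α = List.replicate (p - i) letter1 ++ List.replicate i letter2) :
    shufflePoly i (p - i) (e letter2) (e letter1) =
      lyndonBracket e (List.replicate (p - i) letter1 ++ List.replicate i letter2) := by
  have hp2 := hp.two_le
  rw [shufflePoly_eq_sum_lyndonBracket_map k e hp h1 hi,
    Finset.sum_eq_single_of_mem (List.replicate (p - i) letter1 ++ List.replicate i letter2),
    lyndonCoeff_replicate_append, one_smul]
  · rw [Finset.mem_filter, mem_lyndonWords]
    refine ⟨⟨?_, isLyndon_replicate_append (by omega) h1⟩, ?_, ?_⟩
    · simp
      omega
    · simp [List.count_replicate]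
    · simp [List.count_replicate]
  · intro α hα hne
    rw [Finset.mem_filter, mem_lyndonWords] at hα
    exact absurd (h α hα.1.2 hα.1.1 hα.2.1) hne

theorem shufflePoly_pred_one (k : Type u) [Field k] {p : ℕ} [CharP k p] {A : Type v} [Ring A]
    [Algebra k A] (e : Fin 2 → A) (hp : p.Prime) :
    shufflePoly (p - 1) 1 (e letter2) (e letter1) =
      lyndonBracket e (letter1 :: List.replicate (p - 1) letter2) := by
  have hp2 := hp.two_le
  have h := shufflePoly_eq_lyndonBracket k e hp (i := p - 1) (by omega) le_rfl ?_
  · rwa [show p - (p - 1) = 1 by omega] at h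
  · intro α hα hl hc
    have := count_letter1_add_count_letter2 α
    rw [show p - (p - 1) = 1 by omega]
    have h := hα.eq_of_count_letter1 (by omega)
    rwa [hl] at h

theorem shufflePoly_one_pred (k : Type u) [Field k] {p : ℕ} [CharP k p] {A : Type v} [Ring A]
    [Algebra k A] (e : Fin 2 → A) (hp : p.Prime) :
    shufflePoly 1 (p - 1) (e letter2) (e letter1) =
      lyndonBracket e (List.replicate (p - 1) letter1 ++ [letter2]) := by
  have hp2 := hp.two_le
  refine shufflePoly_eq_lyndonBracket k e hp (i := 1) le_rfl (by omega) ?_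
  intro α hα hl hc
  have h := hα.eq_of_count_letter2 hc
  rwa [hl] at h

theorem add_pow_of_count_letter1 (k : Type u) [Field k] {p : ℕ} [CharP k p] {A : Type v} [Ring A]
    [Algebra k A] {e : Fin 2 → A} (hp : p.Prime)
    (h : ∀ α ∈ lyndonWords p, 2 ≤ α.count letter1 → lyndonBracket e α = 0) :
    (∀ i : ℕ, 1 ≤ i → i ≤ p - 2 → shufflePoly i (p - i) (e letter2) (e letter1) = 0) ∧
      (e letter1 + e letter2) ^ p = e letter2 ^ p +
        lyndonBracket e (letter1 :: List.replicate (p - 1) letter2) + e letter1 ^ p := by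
  have hp2 := hp.two_le
  -- Here `α(1) = p - i ≥ 2`, so every term of the expansion vanishes.
  have h0 : ∀ i : ℕ, 1 ≤ i → i ≤ p - 2 → shufflePoly i (p - i) (e letter2) (e letter1) = 0 :=
    fun i h1 hi => shufflePoly_eq_zero_of_lyndonBracket k hp h1 (by omega) fun α hα _ hc =>
      h α hα (by omega)
  refine ⟨h0, ?_⟩
  rw [add_pow_eq_shufflePoly_middle hp.one_le,
    Finset.sum_eq_single_of_mem (p - 1) (by rw [Finset.mem_Ioo]; omega),
    show p - (p - 1) = 1 by omega, shufflePoly_pred_one k e hp]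
  intro i hi hne
  rw [Finset.mem_Ioo] at hi
  exact h0 i (by omega) (by omega)

theorem add_pow_of_count_letter2 (k : Type u) [Field k] {p : ℕ} [CharP k p] {A : Type v} [Ring A]
    [Algebra k A] {e : Fin 2 → A} (hp : p.Prime)
    (h : ∀ α ∈ lyndonWords p, 2 ≤ α.count letter2 → lyndonBracket e α = 0) :
    (∀ i : ℕ, 2 ≤ i → i ≤ p - 1 → shufflePoly i (p - i) (e letter2) (e letter1) = 0) ∧
      (e letter1 + e letter2) ^ p = e letter2 ^ p +
        lyndonBracket e (List.replicate (p - 1) letter1 ++ [letter2]) + e letter1 ^ p := by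
  have hp2 := hp.two_le
  have h0 : ∀ i : ℕ, 2 ≤ i → i ≤ p - 1 → shufflePoly i (p - i) (e letter2) (e letter1) = 0 :=
    fun i h1 hi => shufflePoly_eq_zero_of_lyndonBracket k hp (by omega) hi fun α hα hc _ =>
      h α hα (by omega)
  refine ⟨h0, ?_⟩
  rw [add_pow_eq_shufflePoly_middle hp.one_le,
    Finset.sum_eq_single_of_mem 1 (by rw [Finset.mem_Ioo]; omega), shufflePoly_one_pred k e hp]
  intro i hi hne
  rw [Finset.mem_Ioo] at hi
  exact h0 i (by omega) (by omega)

end Expansion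

end LyndonShirshov

open LyndonShirshov in
theorem mainTheorem9 (k : Type*) [Field k] :
    -- (a)
    (∀ s t : ℕ, 1 ≤ s + t →
      lyndonCoeff k (List.replicate s letter1 ++ List.replicate t letter2) = 1) ∧
    ∀ p : ℕ, p.Prime → CharP k p →
      -- (b)
      (∀ i : ℕ, 1 ≤ i → i ≤ p - 1 →
        shufflePoly i (p - i) (FreeAlgebra.ι k letter2) (FreeAlgebra.ι k letter1) =
          ∑ α ∈ lyndonWords p with α.count letter2 = i ∧ α.count letter1 = p - i,
            lyndonCoeff k α • lyndonBracket (FreeAlgebra.ι k) α) ∧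
      ((FreeAlgebra.ι k letter1 + FreeAlgebra.ι k letter2) ^ p =
        FreeAlgebra.ι k letter2 ^ p +
          ∑ α ∈ lyndonWords p, lyndonCoeff k α • lyndonBracket (FreeAlgebra.ι k) α +
          FreeAlgebra.ι k letter1 ^ p) ∧
      -- (c)
      ∀ (A : Type*) [Ring A] [Algebra k A] (e : Fin 2 → A),
        ((∀ α ∈ lyndonWords p, 2 ≤ α.count letter1 → lyndonBracket e α = 0) →
          (∀ i : ℕ, 1 ≤ i → i ≤ p - 2 → shufflePoly i (p - i) (e letter2) (e letter1) = 0) ∧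
          shufflePoly (p - 1) 1 (e letter2) (e letter1) =
            lyndonBracket e (letter1 :: List.replicate (p - 1) letter2) ∧
          (e letter1 + e letter2) ^ p = e letter2 ^ p +
            lyndonBracket e (letter1 :: List.replicate (p - 1) letter2) + e letter1 ^ p) ∧
        ((∀ α ∈ lyndonWords p, 2 ≤ α.count letter2 → lyndonBracket e α = 0) →
          (∀ i : ℕ, 2 ≤ i → i ≤ p - 1 → shufflePoly i (p - i) (e letter2) (e letter1) = 0) ∧
          shufflePoly 1 (p - 1) (e letter2) (e letter1) =
            lyndonBracket e (List.replicate (p - 1) letter1 ++ [letter2]) ∧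
          (e letter1 + e letter2) ^ p = e letter2 ^ p +
            lyndonBracket e (List.replicate (p - 1) letter1 ++ [letter2]) + e letter1 ^ p) := by
  refine ⟨fun s t _ => lyndonCoeff_replicate_append s t, fun p hp _ => ⟨fun i h1 hi =>
    shufflePoly_eq_sum_lyndonBracket k hp h1 hi, add_pow_eq_sum_lyndonBracket k hp, ?_⟩⟩
  intro A _ _ e
  refine ⟨fun h => ?_, fun h => ?_⟩
  · obtain ⟨h1, h2⟩ := add_pow_of_count_letter1 k hp h
    exact ⟨h1, shufflePoly_pred_one k e hp, h2⟩
  · obtain ⟨h1, h2⟩ := add_pow_of_count_letter2 k hp h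
    exact ⟨h1, shufflePoly_one_pred k e hp, h2⟩
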